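/- Let $K$ be a field of characteristic different from $2$, and for nonzero elements $a,b$ of a field $F$ let $(a,b)$ denote the quaternion $F$-algebra with basis $1,i,j,ij$ and relations $i^2=a$, $j^2=b$, $ij=-ji$, as well as its class in $\mathrm{Br}(F)$. Let $q$ be a nondegenerate quadratic form of rank $6$ over $K$ whose signed discriminant $\Delta=-\det(M)$, where $M$ is the Gram symmetric matrix of $q$ in some basis, is not a square in $K$, and let $L=K(\sqrt{\Delta})$ be its discriminant extension. Then the center of the even Clifford algebra $C_0(q)$ is $K$-isomorphic to $L$. For every identification of the center with $L$ over $K$, $C_0(q)$ is a central simple $L$-algebra. Its class $c_0(q)\in\mathrm{Br}(L)$ satisfies the following. (a) If $q\cong\langle a_1,\dots,a_6\rangle$ with $a_1,\dots,a_6\in K$, then $$c_0(q)=(-a_1a_2,\,-a_1a_3)\otimes(a_1a_2a_3a_4,\,a_1a_2a_3a_5)\quad\text{in }\mathrm{Br}(L).$$ (b) Let $m_i$ be the determinant of the leading principal $i\times i$ submatrix of the Gram symmetric matrix of $q$ with respect to a given basis. If $m_1,\dots,m_5$ are nonzero, then $$c_0(q)=(-m_2,\,-m_1m_3)\otimes(m_4,\,-m_3m_5)\quad\text{in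 }\mathrm{Br}(L).$$ -/

import Mathlib

universe u

open scoped TensorProduct Quaternion

noncomputable section

/-- The signed discriminant `(-1)^(n(n-1)/2) * det M` of a quadratic form on an `n`-dimensional
space, where `M` is its Gram symmetric matrix with respect to the basis `b`.  (A change of basis
multiplies it by a nonzero square.)  For `n = 6` it is `-det M`. -/
def signedDiscriminant {K V : Type*} [Field K] [Invertible (2 : K)] [AddCommGroup V] [Module K V]
    {n : ℕ} (b : Module.Basis (Fin n) K V) (q : QuadraticForm K V) : K :=
  (-1) ^ (n * (n - 1) / 2) * QuadraticForm.discr b q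

/-- `L` is the discriminant extension `K(√Δ)` of `q`, and it is nontrivial, i.e. the signed
discriminant `Δ` of `q` is not a square in `K`. -/
structure IsNontrivialDiscriminantExtension {K V : Type*} (L : Type*) [Field K]
    [Invertible (2 : K)] [AddCommGroup V] [Module K V] [Field L] [Algebra K L]
    {n : ℕ} (b : Module.Basis (Fin n) K V) (q : QuadraticForm K V) : Prop where
  not_isSquare : ¬ IsSquare (signedDiscriminant b q)
  exists_sqrt : ∃ δ : L, δ ^ 2 = algebraMap K L (signedDiscriminant b q) ∧
    IntermediateField.adjoin K {δ} = ⊤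

/-- The determinant of the leading principal `i × i` submatrix of an `n × n` matrix. -/
def leadingPrincipalMinor {K : Type*} [CommRing K] {n : ℕ} (M : Matrix (Fin n) (Fin n) K)
    (i : ℕ) (hi : i ≤ n) : K :=
  (M.submatrix (Fin.castLE hi) (Fin.castLE hi)).det

section EvenClifford

variable {K L V : Type*} [Field K] [Field L] [Algebra K L] [AddCommGroup V] [Module K V]
  {q : QuadraticForm K V}

/-- The even Clifford algebra `C₀(q)`, to be regarded as an algebra over `L` by means of an
identification `φ` over `K` of `L` with the center of `C₀(q)`. -/
def EvenCliffordOver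
    (_φ : L ≃ₐ[K] Subalgebra.center K (CliffordAlgebra.even q)) : Type _ :=
  CliffordAlgebra.even q

instance EvenCliffordOver.instRing
    (φ : L ≃ₐ[K] Subalgebra.center K (CliffordAlgebra.even q)) : Ring (EvenCliffordOver φ) :=
  inferInstanceAs (Ring (CliffordAlgebra.even q))

/-- The scalar `x : L` acts on `C₀(q)` as multiplication by the central element `φ x`. -/
instance EvenCliffordOver.instAlgebra
    (φ : L ≃ₐ[K] Subalgebra.center K (CliffordAlgebra.even q)) :
    Algebra L (EvenCliffordOver φ) :=
  RingHom.toAlgebra' (S := CliffordAlgebra.even q)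
    (((Subalgebra.center K (CliffordAlgebra.even q)).val.comp φ.toAlgHom).toRingHom)
    (fun x y => ((Subalgebra.mem_center_iff.mp (φ x).2) y).symm)

end EvenClifford

/-- The `F`-algebra `A` is a finite-dimensional central simple algebra, and `β` is its class in
the Brauer group of `F`. -/
def HasBrauerClass (F A : Type u) [Field F] [Ring A] [Algebra F A]
    (β : BrauerGroup.{u, u} F) : Prop :=
  ∃ B : CSA.{u, u} F, Nonempty (A ≃ₐ[F] B) ∧ Quotient.mk (Brauer.CSA_Setoid F) B = β

/-- For a quadratic form `q` over `K` and an extension `L` of `K`: the center of the even Clifford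
algebra `C₀(q)` is isomorphic to `L` over `K` and, however it is identified with `L`, `C₀(q)` is a
central simple algebra over `L` whose class in `Br(L)` is `(α, β) ⊗ (γ, δ)`, the class of the
tensor product of two quaternion algebras.  Here `ℍ[L, α, β]` is the algebra with `L`-basis
`1, i, j, ij`, where `i² = α`, `j² = β`, `ij = -ji`. -/
def EvenCliffordClassEq {K V L : Type u} [Field K] [AddCommGroup V] [Module K V]
    [Field L] [Algebra K L] (q : QuadraticForm K V) (α β γ δ : L) : Prop :=
  Nonempty (L ≃ₐ[K] Subalgebra.center K (CliffordAlgebra.even q)) ∧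
  ∀ φ : L ≃ₐ[K] Subalgebra.center K (CliffordAlgebra.even q),
    ∃ c₀ : BrauerGroup.{u, u} L, HasBrauerClass L (EvenCliffordOver φ) c₀ ∧
      HasBrauerClass L (ℍ[L, α, β] ⊗[L] ℍ[L, γ, δ]) c₀

end

/-!
Let `v₀, …, v₅` be an orthogonal basis.  The products `v₀ vᵢ`, for `1 ≤ i ≤ 5`, generate `C₀(q)`,
anticommute pairwise and have scalar squares.  As there is an odd number of them, their product is
central; up to a scalar its square is the signed discriminant, so it generates a copy of `L` in the
center.  Over `L` the fifth generator is redundant.  The first two generate a quaternion algebra,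
and multiplying the third and the fourth by the product of the first two makes them commute with it
while they still anticommute with each other.  Hence `C₀(q)` is, over `L`, a tensor product of two
quaternion algebras, which is central simple, so that its center is no larger than `L`.

For (b), the Gram–Schmidt process provides an orthogonal basis with `q(vᵢ) = mᵢ₊₁ / mᵢ`, and the
symbols of (a) are simplified by `(α, β) = (α, -αβ)`.
-/

section CentralSimple

variable {F A B C : Type*} [Field F] [Ring A] [Algebra F A] [Ring B] [Algebra F B] [Ring C]
  [Algebra F C]

theorem exists_eq_one_tmul_of_commute [Algebra.IsCentral F A] {x : A ⊗[F] B}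
    (hx : ∀ a : A, Commute (a ⊗ₜ 1) x) : ∃ b : B, x = 1 ⊗ₜ b := by
  have hmem : x ∈ Subalgebra.centralizer F
      ((Algebra.TensorProduct.includeLeft : A →ₐ[F] A ⊗[F] B).range : Set (A ⊗[F] B)) :=
    (Subalgebra.mem_centralizer_iff F).2 fun _ ⟨a, ha⟩ => ha ▸ (hx a).eq
  rw [Subalgebra.centralizer_coe_range_includeLeft_eq_center_tensorProduct] at hmem
  obtain ⟨y, rfl⟩ := hmem
  clear hx
  induction y with
  | zero => exact ⟨0, by simp⟩
  | tmul z b =>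
    obtain ⟨c, hc⟩ := (Algebra.IsCentral.mem_center_iff F).1 z.2
    exact ⟨c • b, by simp [hc, Algebra.algebraMap_eq_smul_one, TensorProduct.smul_tmul]⟩
  | add y₁ y₂ h₁ h₂ =>
    obtain ⟨b₁, h₁⟩ := h₁
    obtain ⟨b₂, h₂⟩ := h₂
    exact ⟨b₁ + b₂, by rw [TensorProduct.tmul_add, ← h₁, ← h₂]; exact map_add _ _ _⟩

theorem isCentral_tensorProduct [Nontrivial A] [Algebra.IsCentral F A] [Algebra.IsCentral F B] :
    Algebra.IsCentral F (A ⊗[F] B) := by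
  refine ⟨fun x hx => ?_⟩
  rw [Subalgebra.mem_center_iff] at hx
  obtain ⟨b, rfl⟩ := exists_eq_one_tmul_of_commute fun a => hx (a ⊗ₜ 1)
  have hb : b ∈ Subalgebra.center F B := Subalgebra.mem_center_iff.2 fun y =>
    Algebra.TensorProduct.includeRight_injective (R := F) (A := A) (algebraMap F A).injective
      (by simpa using hx (1 ⊗ₜ y))
  obtain ⟨c, rfl⟩ := (Algebra.IsCentral.mem_center_iff F).1 hb
  exact Algebra.mem_bot.2
    ⟨c, by simp [Algebra.algebraMap_eq_smul_one, Algebra.TensorProduct.one_def]⟩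

section Coefficients

variable {ι : Type*} (e : Module.Basis ι F B)

theorem basis_repr_tmul_one_mul (a : A) (x : A ⊗[F] B) (i : ι) :
    (Algebra.TensorProduct.basis A e).repr (a ⊗ₜ 1 * x) i =
      a * (Algebra.TensorProduct.basis A e).repr x i := by
  induction x with
  | zero => simp
  | tmul a' b => simp [mul_assoc]
  | add x y hx hy => simp [mul_add, hx, hy]

theorem basis_repr_mul_tmul_one (a : A) (x : A ⊗[F] B) (i : ι) :
    (Algebra.TensorProduct.basis A e).repr (x * a ⊗ₜ 1) i =
      (Algebra.TensorProduct.basis A e).repr x i * a := by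
  induction x with
  | zero => simp
  | tmul a' b => simp [mul_assoc, Algebra.commutes]
  | add x y hx hy => simp [add_mul, hx, hy]

/-- The ideal of `A` formed by the `i`-th coefficients, in the basis `1 ⊗ e`, of the elements of
a two-sided ideal of `A ⊗ B` all of whose coefficients outside `s` vanish. -/
def coefficientIdeal (I : TwoSidedIdeal (A ⊗[F] B)) (s : Finset ι) (i : ι) : TwoSidedIdeal A :=
  TwoSidedIdeal.mk'
    {a | ∃ y ∈ I, (∀ j ∉ s, (Algebra.TensorProduct.basis A e).repr y j = 0) ∧
      (Algebra.TensorProduct.basis A e).repr y i = a}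
    ⟨0, I.zero_mem, by simp⟩
    (by
      rintro _ _ ⟨y, hy, hys, rfl⟩ ⟨z, hz, hzs, rfl⟩
      exact ⟨y + z, I.add_mem hy hz, by simp +contextual [hys, hzs]⟩)
    (by
      rintro _ ⟨y, hy, hys, rfl⟩
      exact ⟨-y, I.neg_mem hy, by simp +contextual [hys]⟩)
    (by
      rintro a _ ⟨y, hy, hys, rfl⟩
      exact ⟨a ⊗ₜ 1 * y, I.mul_mem_left _ _ hy,
        by simp +contextual [hys, basis_repr_tmul_one_mul]⟩)
    (by
      rintro _ a ⟨y, hy, hys, rfl⟩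
      exact ⟨y * a ⊗ₜ 1, I.mul_mem_right _ _ hy,
        by simp +contextual [hys, basis_repr_mul_tmul_one]⟩)

theorem mem_coefficientIdeal {I : TwoSidedIdeal (A ⊗[F] B)} {s : Finset ι} {i : ι} {a : A} :
    a ∈ coefficientIdeal e I s i ↔
      ∃ y ∈ I, (∀ j ∉ s, (Algebra.TensorProduct.basis A e).repr y j = 0) ∧
        (Algebra.TensorProduct.basis A e).repr y i = a := by
  rw [coefficientIdeal, TwoSidedIdeal.mem_mk']
  rfl

end Coefficients

theorem exists_ne_zero_one_tmul_mem [Algebra.IsCentral F A] [IsSimpleRing A]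
    {I : TwoSidedIdeal (A ⊗[F] B)} (hI : I ≠ ⊥) : ∃ b : B, b ≠ 0 ∧ 1 ⊗ₜ b ∈ I := by
  let e := Module.Basis.ofVectorSpace F B
  let coeff := (Algebra.TensorProduct.basis A e).repr
  obtain ⟨x₀, hx₀, hx₀_ne⟩ : ∃ x ∈ I, x ≠ 0 := by
    by_contra! h
    exact hI (eq_bot_iff.2 fun x hx => (TwoSidedIdeal.mem_bot _).2 (h x hx))
  obtain ⟨x, ⟨hx, hx_ne⟩, hmin⟩ := exists_minimalFor_of_wellFoundedLT
    (fun x => x ∈ I ∧ x ≠ 0) (fun x => (coeff x).support) ⟨x₀, hx₀, hx₀_ne⟩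
  obtain ⟨i, hi⟩ : ∃ i, coeff x i ≠ 0 := by
    by_contra! h
    exact hx_ne (coeff.map_eq_zero_iff.1 (Finsupp.ext h))
  obtain ⟨y, hy, hys, hyi⟩ : ∃ y ∈ I, (∀ j ∉ (coeff x).support, coeff y j = 0) ∧ coeff y i = 1 :=
    (mem_coefficientIdeal e).1 <| IsSimpleRing.one_mem_of_ne_zero_mem _ hi <|
      (mem_coefficientIdeal e).2 ⟨x, hx, fun j => Finsupp.notMem_support_iff.1, rfl⟩
  have hcomm (a : A) : a ⊗ₜ 1 * y - y * a ⊗ₜ 1 = 0 := by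
    by_contra hne
    have hcoeff (j : _) : coeff (a ⊗ₜ 1 * y - y * a ⊗ₜ 1) j = a * coeff y j - coeff y j * a := by
      simp [coeff, basis_repr_tmul_one_mul, basis_repr_mul_tmul_one]
    refine Finsupp.mem_support_iff.1 (hmin
      ⟨I.sub_mem (I.mul_mem_left _ _ hy) (I.mul_mem_right _ _ hy), hne⟩ (fun j hj => ?_)
      (Finsupp.mem_support_iff.2 hi)) (by rw [hcoeff, hyi, mul_one, one_mul, sub_self])
    by_contra hjs
    exact Finsupp.mem_support_iff.1 hj (by rw [hcoeff, hys j hjs, mul_zero, zero_mul, sub_zero])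
  obtain ⟨b, rfl⟩ := exists_eq_one_tmul_of_commute fun a => sub_eq_zero.1 (hcomm a)
  refine ⟨b, ?_, hy⟩
  rintro rfl
  simp at hyi

theorem isSimpleRing_tensorProduct [Algebra.IsCentral F A] [IsSimpleRing A] [IsSimpleRing B] :
    IsSimpleRing (A ⊗[F] B) := by
  have : Nontrivial (A ⊗[F] B) := (Algebra.TensorProduct.includeRight_injective (R := F) (A := A)
    (B := B) (algebraMap F A).injective).nontrivial
  refine ⟨⟨fun I => or_iff_not_imp_left.2 fun hI => (TwoSidedIdeal.one_mem_iff I).1 ?_⟩⟩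
  obtain ⟨b, hb, hbI⟩ := exists_ne_zero_one_tmul_mem hI
  let includeRight : B →ₐ[F] A ⊗[F] B := Algebra.TensorProduct.includeRight
  have h1 : (1 : B) ∈ I.comap includeRight :=
    IsSimpleRing.one_mem_of_ne_zero_mem _ hb (TwoSidedIdeal.mem_comap _ |>.2 hbI)
  simpa using (TwoSidedIdeal.mem_comap _).1 h1

theorem nonempty_tensorProduct_algEquiv [Nontrivial A] [Algebra.IsCentral F B] [IsSimpleRing B]
    [IsSimpleRing C] (f : B →ₐ[F] A) (g : C →ₐ[F] A) (hfg : ∀ x y, Commute (f x) (g y))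
    (htop : f.range ⊔ g.range = ⊤) : Nonempty (B ⊗[F] C ≃ₐ[F] A) := by
  have : IsSimpleRing (B ⊗[F] C) := isSimpleRing_tensorProduct
  let h := Algebra.TensorProduct.lift f g hfg
  refine ⟨AlgEquiv.ofBijective h ⟨h.toRingHom.injective, ?_⟩⟩
  rw [← AlgHom.range_eq_top, eq_top_iff, ← htop]
  refine sup_le ?_ ?_
  · rintro _ ⟨x, rfl⟩
    exact ⟨x ⊗ₜ 1, by simp [h]⟩
  · rintro _ ⟨y, rfl⟩
    exact ⟨1 ⊗ₜ y, by simp [h]⟩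

end CentralSimple

section Quaternion

variable {F A : Type*} [Field F] [Ring A] [Algebra F A] {a b c d : F}

theorem add_conj_eq_four_mul_re (ha : a ≠ 0) (hb : b ≠ 0) (x : ℍ[F, a, b]) :
    x + a⁻¹ • (⟨0, 1, 0, 0⟩ * x * ⟨0, 1, 0, 0⟩) + b⁻¹ • (⟨0, 0, 1, 0⟩ * x * ⟨0, 0, 1, 0⟩)
      - (a * b)⁻¹ • (⟨0, 0, 0, 1⟩ * x * ⟨0, 0, 0, 1⟩) = (4 * x.re) • (1 : ℍ[F, a, b]) := by
  ext <;> simp <;> field_simp <;> ring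

theorem isSimpleRing_quaternionAlgebra (h2 : (2 : F) ≠ 0) (ha : a ≠ 0) (hb : b ≠ 0) :
    IsSimpleRing ℍ[F, a, b] := by
  have h4 : (4 : F) ≠ 0 := by simpa [show (4 : F) = 2 * 2 by norm_num] using h2
  refine ⟨⟨fun I => or_iff_not_imp_left.2 fun hI => by_contra fun htop => hI ?_⟩⟩
  have smul_mem (r : F) {x : ℍ[F, a, b]} (hx : x ∈ I) : r • x ∈ I := by
    simpa only [Algebra.smul_def] using I.mul_mem_left (algebraMap F _ r) x hx
  have re_eq_zero {x : ℍ[F, a, b]} (hx : x ∈ I) : x.re = 0 := by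
    have conj_mem (y : ℍ[F, a, b]) : y * x * y ∈ I := I.mul_mem_right _ _ (I.mul_mem_left _ _ hx)
    have hmem : (4 * x.re) • (1 : ℍ[F, a, b]) ∈ I := by
      rw [← add_conj_eq_four_mul_re ha hb]
      exact I.sub_mem (I.add_mem (I.add_mem hx (smul_mem _ (conj_mem _)))
        (smul_mem _ (conj_mem _))) (smul_mem _ (conj_mem _))
    by_contra hre
    refine htop ((TwoSidedIdeal.one_mem_iff I).1 ?_)
    simpa only [smul_smul, inv_mul_cancel₀ (mul_ne_zero h4 hre), one_smul] using
      smul_mem (4 * x.re)⁻¹ hmem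
  refine eq_bot_iff.2 fun x hx => (TwoSidedIdeal.mem_bot _).2 ?_
  have hi := re_eq_zero (I.mul_mem_left ⟨0, 1, 0, 0⟩ x hx)
  have hj := re_eq_zero (I.mul_mem_left ⟨0, 0, 1, 0⟩ x hx)
  have hk := re_eq_zero (I.mul_mem_left ⟨0, 0, 0, 1⟩ x hx)
  ext
  · exact re_eq_zero hx
  · simpa [ha] using hi
  · simpa [hb] using hj
  · simpa [ha, hb] using hk

theorem isCentral_quaternionAlgebra (h2 : (2 : F) ≠ 0) (ha : a ≠ 0) :
    Algebra.IsCentral F ℍ[F, a, b] := by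
  refine ⟨fun x hx => Algebra.mem_bot.2 ⟨x.re, ?_⟩⟩
  have eq_zero_of_eq_neg {r : F} (h : r = -r) : r = 0 := by
    simpa [h2, ← two_mul] using eq_neg_iff_add_eq_zero.1 h
  have hi := Subalgebra.mem_center_iff.1 hx ⟨0, 1, 0, 0⟩
  have hj := Subalgebra.mem_center_iff.1 hx ⟨0, 0, 1, 0⟩
  have imI_eq_zero : x.imI = 0 := eq_zero_of_eq_neg <| by
    simpa using (congrArg QuaternionAlgebra.imK hj).symm
  have imJ_eq_zero : x.imJ = 0 := eq_zero_of_eq_neg <| by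
    simpa using congrArg QuaternionAlgebra.imK hi
  have imK_eq_zero : x.imK = 0 := (mul_eq_zero_iff_left ha).1 <| eq_zero_of_eq_neg <| by
    simpa using congrArg QuaternionAlgebra.imJ hi
  ext <;> simp [imI_eq_zero, imJ_eq_zero, imK_eq_zero]

theorem isSimpleRing_biquaternion (h2 : (2 : F) ≠ 0) (ha : a ≠ 0) (hb : b ≠ 0) (hc : c ≠ 0)
    (hd : d ≠ 0) : IsSimpleRing (ℍ[F, a, b] ⊗[F] ℍ[F, c, d]) :=
  have := isCentral_quaternionAlgebra (b := b) h2 ha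
  have := isSimpleRing_quaternionAlgebra h2 ha hb
  have := isSimpleRing_quaternionAlgebra h2 hc hd
  isSimpleRing_tensorProduct

theorem isCentral_biquaternion (h2 : (2 : F) ≠ 0) (ha : a ≠ 0) (hc : c ≠ 0) :
    Algebra.IsCentral F (ℍ[F, a, b] ⊗[F] ℍ[F, c, d]) :=
  have := isCentral_quaternionAlgebra (b := b) h2 ha
  have := isCentral_quaternionAlgebra (b := d) h2 hc
  isCentral_tensorProduct

theorem nonempty_quaternionAlgebra_algEquiv [Nontrivial A] (h2 : (2 : F) ≠ 0) (ha : a ≠ 0)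
    (hb : b ≠ 0) (hA : Module.finrank F A = 4)
    (p : QuaternionAlgebra.Basis A a 0 b) : Nonempty (ℍ[F, a, b] ≃ₐ[F] A) := by
  have := isSimpleRing_quaternionAlgebra h2 ha hb
  have : FiniteDimensional F A := .of_finrank_pos (by rw [hA]; norm_num)
  have hinj : Function.Injective p.liftHom := p.liftHom.toRingHom.injective
  have hfinrank : Module.finrank F ℍ[F, a, b] = Module.finrank F A := by
    rw [hA, QuaternionAlgebra.finrank_eq_four]
  have hsurj : Function.Surjective p.liftHom :=
    (LinearMap.injective_iff_surjective_of_finrank_eq_finrank hfinrank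
      (f := p.liftHom.toLinearMap)).1 hinj
  exact ⟨AlgEquiv.ofBijective p.liftHom ⟨hinj, hsurj⟩⟩

theorem nonempty_quaternionAlgebra_algEquiv_neg_mul (h2 : (2 : F) ≠ 0) (ha : a ≠ 0) (hb : b ≠ 0) :
    Nonempty (ℍ[F, a, b] ≃ₐ[F] ℍ[F, a, -(a * b)]) :=
  nonempty_quaternionAlgebra_algEquiv h2 ha hb (QuaternionAlgebra.finrank_eq_four a 0 _)
    { i := ⟨0, 1, 0, 0⟩
      j := ⟨0, 0, 0, a⁻¹⟩
      k := ⟨0, 0, 1, 0⟩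
      i_mul_i := by ext <;> simp
      j_mul_j := by ext <;> simp; field_simp
      i_mul_j := by ext <;> simp [ha]
      j_mul_i := by ext <;> simp [ha] }

theorem nonempty_quaternionAlgebra_algEquiv_mul_sq (h2 : (2 : F) ≠ 0) (ha : a ≠ 0) (hb : b ≠ 0)
    {s t : F} (hs : s ≠ 0) (ht : t ≠ 0) :
    Nonempty (ℍ[F, a, b] ≃ₐ[F] ℍ[F, s ^ 2 * a, t ^ 2 * b]) :=
  nonempty_quaternionAlgebra_algEquiv h2 ha hb (QuaternionAlgebra.finrank_eq_four _ 0 _)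
    { i := ⟨0, s⁻¹, 0, 0⟩
      j := ⟨0, 0, t⁻¹, 0⟩
      k := ⟨0, 0, 0, s⁻¹ * t⁻¹⟩
      i_mul_i := by ext <;> simp; field_simp
      j_mul_j := by ext <;> simp; field_simp
      i_mul_j := by ext <;> simp
      j_mul_i := by ext <;> simp [mul_comm] }

theorem commute_liftHom (p : QuaternionAlgebra.Basis A a 0 b) {y : A}
    (hi : Commute p.i y) (hj : Commute p.j y) (x : ℍ[F, a, b]) : Commute (p.liftHom x) y := by
  have hk : Commute p.k y := p.i_mul_j ▸ hi.mul_left hj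
  exact (((Algebra.commute_algebraMap_left x.re y).add_left (hi.smul_left _)).add_left
    (hj.smul_left _)).add_left (hk.smul_left _)

theorem nonempty_biquaternion_algEquiv [Nontrivial A] (h2 : (2 : F) ≠ 0) (ha : a ≠ 0) (hb : b ≠ 0)
    (hc : c ≠ 0) (hd : d ≠ 0) (p : QuaternionAlgebra.Basis A a 0 b)
    (r : QuaternionAlgebra.Basis A c 0 d) (hii : Commute p.i r.i) (hij : Commute p.i r.j)
    (hji : Commute p.j r.i) (hjj : Commute p.j r.j)
    (htop : Algebra.adjoin F {p.i, p.j, r.i, r.j} = ⊤) :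
    Nonempty (ℍ[F, a, b] ⊗[F] ℍ[F, c, d] ≃ₐ[F] A) := by
  have := isSimpleRing_quaternionAlgebra h2 ha hb
  have := isCentral_quaternionAlgebra (b := b) h2 ha
  have := isSimpleRing_quaternionAlgebra h2 hc hd
  refine nonempty_tensorProduct_algEquiv p.liftHom r.liftHom (fun x y => ?_) ?_
  · exact commute_liftHom p (commute_liftHom r hii.symm hij.symm y).symm
      (commute_liftHom r hji.symm hjj.symm y).symm x
  · rw [eq_top_iff, ← htop, QuaternionAlgebra.Basis.range_liftHom,
      QuaternionAlgebra.Basis.range_liftHom, ← Algebra.adjoin_union]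
    exact Algebra.adjoin_mono (by grind)

end Quaternion

section CliffordSystem

variable {ι F A : Type*} [Field F] [Ring A] [Algebra F A]

/-- Pairwise anticommuting elements `e i` with scalar squares `a i`: the relations satisfied by an
orthogonal family in the Clifford algebra of `⟨a₁, …, aₙ⟩`. -/
structure IsCliffordSystem (a : ι → F) (e : ι → A) : Prop where
  mul_self : ∀ i, e i * e i = algebraMap F A (a i)
  anticomm : ∀ {i j}, i ≠ j → e i * e j = -(e j * e i)

/-- The ordered product of a finite family, to be thought of as its volume element. -/
def volumeElement {n : ℕ} (e : Fin n → A) : A :=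
  (List.ofFn e).prod

theorem volumeElement_succ {n : ℕ} (e : Fin (n + 1) → A) :
    volumeElement e = e 0 * volumeElement (fun i => e i.succ) := by
  simp [volumeElement, List.ofFn_succ]

theorem volumeElement_mul_of_anticomm {n : ℕ} {e : Fin n → A} {x : A}
    (hx : ∀ i, e i * x = -(x * e i)) :
    volumeElement e * x = (-1 : ℤ) ^ n • (x * volumeElement e) := by
  induction n with
  | zero => simp [volumeElement]
  | succ n ih =>
    rw [volumeElement_succ, mul_assoc, ih fun i => hx i.succ, mul_smul_comm, ← mul_assoc, hx 0,
      neg_mul, mul_assoc, pow_succ, mul_neg_one, neg_smul, smul_neg]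

namespace IsCliffordSystem

variable {a : ι → F} {e : ι → A}

theorem comp (h : IsCliffordSystem a e) {κ : Type*} {f : κ → ι} (hf : f.Injective) :
    IsCliffordSystem (fun k => a (f k)) (fun k => e (f k)) :=
  ⟨fun k => h.mul_self (f k), fun hkl => h.anticomm (hf.ne hkl)⟩

theorem extendScalars (h : IsCliffordSystem a e) (L : Type*) [Field L] [Algebra F L] [Algebra L A]
    [IsScalarTower F L A] : IsCliffordSystem (fun i => algebraMap F L (a i)) e :=
  ⟨fun i => by rw [h.mul_self, IsScalarTower.algebraMap_apply F L A], h.anticomm⟩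

/-- The quaternion algebra generated by two members of a Clifford system. -/
@[simps]
def quaternionBasis (h : IsCliffordSystem a e) {i j : ι} (hij : i ≠ j) :
    QuaternionAlgebra.Basis A (a i) 0 (a j) where
  i := e i
  j := e j
  k := e i * e j
  i_mul_i := by simp [h.mul_self, Algebra.algebraMap_eq_smul_one]
  j_mul_j := by simp [h.mul_self, Algebra.algebraMap_eq_smul_one]
  i_mul_j := rfl
  j_mul_i := by simp [h.anticomm hij.symm]

theorem mem_of_mul_mem (h : IsCliffordSystem a e) {i : ι} (hi : a i ≠ 0) {S : Subalgebra F A}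
    (hiS : e i ∈ S) {x : A} (hx : e i * x ∈ S) : x ∈ S := by
  have := S.smul_mem (S.mul_mem hiS hx) (a i)⁻¹
  rwa [← mul_assoc, h.mul_self, ← Algebra.smul_def, inv_smul_smul₀ hi] at this

theorem commute_mul (h : IsCliffordSystem a e) {i j k : ι} (hik : i ≠ k) (hjk : j ≠ k) :
    Commute (e i * e j) (e k) := by
  rw [commute_iff_eq, mul_assoc, h.anticomm hjk, mul_neg, ← mul_assoc, h.anticomm hik, neg_mul,
    neg_neg, mul_assoc]

theorem mul_mul_self (h : IsCliffordSystem a e) {i j : ι} (hij : i ≠ j) :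
    e i * e j * (e i * e j) = algebraMap F A (-(a i * a j)) := by
  rw [mul_assoc, ← mul_assoc (e j), h.anticomm hij.symm, neg_mul, mul_assoc, h.mul_self,
    mul_neg, ← mul_assoc, h.mul_self, map_neg, map_mul]

theorem mul_mul (h : IsCliffordSystem a e) {i j : ι} (hij : i ≠ j) {κ : Type*} {f : κ → ι}
    (hf : f.Injective) (hi : ∀ k, i ≠ f k) (hj : ∀ k, j ≠ f k) :
    IsCliffordSystem (fun k => -(a i * a j * a (f k))) (fun k => e i * e j * e (f k)) := by
  have mul_eq (k l : κ) : e i * e j * e (f k) * (e i * e j * e (f l)) =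
      algebraMap F A (-(a i * a j)) * (e (f k) * e (f l)) := by
    rw [mul_assoc, ← mul_assoc (e (f k)), ← (h.commute_mul (hi k) (hj k)).eq, mul_assoc (e i * e j),
      ← mul_assoc, h.mul_mul_self hij]
  refine ⟨fun k => ?_, fun {k l} hkl => ?_⟩
  · rw [mul_eq, h.mul_self, ← map_mul, neg_mul]
  · rw [mul_eq, mul_eq, h.anticomm (hf.ne hkl), mul_neg]

theorem commute_left_mul_mul (h : IsCliffordSystem a e) {i j k : ι} (hij : i ≠ j) (hik : i ≠ k) :
    Commute (e i) (e i * e j * e k) := by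
  rw [mul_assoc, commute_iff_eq, mul_assoc (e i), (h.commute_mul hij.symm hik.symm).eq]

theorem commute_right_mul_mul (h : IsCliffordSystem a e) {i j k : ι} (hij : i ≠ j) (hjk : j ≠ k) :
    Commute (e j) (e i * e j * e k) := by
  rw [h.anticomm hij, neg_mul]
  exact (h.commute_left_mul_mul hij.symm hjk).neg_right

theorem volumeElement_mul_self {n : ℕ} {a : Fin n → F} {e : Fin n → A}
    (h : IsCliffordSystem a e) :
    volumeElement e * volumeElement e =
      algebraMap F A ((-1) ^ (n * (n - 1) / 2) * ∏ i, a i) := by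
  induction n with
  | zero => simp [volumeElement]
  | succ n ih =>
    let t := volumeElement fun i => e i.succ
    have ht : t * e 0 = (-1 : ℤ) ^ n • (e 0 * t) :=
      volumeElement_mul_of_anticomm fun i => h.anticomm i.succ_ne_zero
    calc volumeElement e * volumeElement e
        = e 0 * (t * e 0) * t := by rw [volumeElement_succ]; simp only [t, mul_assoc]
      _ = (-1 : ℤ) ^ n • (e 0 * e 0 * (t * t)) := by
          rw [ht, mul_smul_comm, smul_mul_assoc]
          simp only [mul_assoc]
      _ = algebraMap F A ((-1) ^ n * a 0 *
            ((-1) ^ (n * (n - 1) / 2) * ∏ i : Fin n, a i.succ)) := by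
          rw [h.mul_self, ih (h.comp (Fin.succ_injective n)), zsmul_eq_mul, mul_assoc]
          simp only [map_mul, map_pow, map_neg, map_one, Int.cast_pow, Int.cast_neg, Int.cast_one]
      _ = algebraMap F A ((-1) ^ ((n + 1) * (n + 1 - 1) / 2) * ∏ i, a i) := by
          rw [Nat.triangle_succ, Fin.prod_univ_succ, pow_add]
          congr 1
          ring

theorem mul_volumeElement {n : ℕ} {a : Fin (n + 1) → F} {e : Fin (n + 1) → A}
    (h : IsCliffordSystem a e) (i : Fin (n + 1)) :
    e i * volumeElement e = (-1 : ℤ) ^ n • (volumeElement e * e i) := by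
  induction n with
  | zero => simp [volumeElement, Fin.fin_one_eq_zero i]
  | succ n ih =>
    rw [volumeElement_succ]
    cases i using Fin.cases with
    | zero =>
      rw [mul_assoc (e 0), volumeElement_mul_of_anticomm fun i => h.anticomm i.succ_ne_zero,
        mul_smul_comm, smul_smul, pow_mul_pow_eq_one _ (by norm_num), one_smul]
    | succ i =>
      rw [← mul_assoc, h.anticomm i.succ_ne_zero, neg_mul, mul_assoc,
        ih (h.comp (Fin.succ_injective _)) i, mul_smul_comm, pow_succ, mul_neg_one, neg_smul,
        mul_assoc]

theorem volumeElement_mem_center {n : ℕ} {a : Fin n → F} {e : Fin n → A}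
    (h : IsCliffordSystem a e) (hn : Odd n) (htop : Algebra.adjoin F (Set.range e) = ⊤) :
    volumeElement e ∈ Subalgebra.center F A := by
  obtain ⟨m, rfl⟩ := hn
  have hle : Algebra.adjoin F (Set.range e) ≤ Subalgebra.centralizer F {volumeElement e} := by
    rw [Algebra.adjoin_le_iff]
    rintro _ ⟨i, rfl⟩
    simp [Set.mem_centralizer_iff, h.mul_volumeElement i]
  refine Subalgebra.mem_center_iff.2 fun x => ?_
  have hx := hle (htop ▸ Algebra.mem_top : x ∈ _)
  exact ((Subalgebra.mem_centralizer_iff F).1 hx _ rfl).symm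

theorem range_subset_of_volumeElement_mem {a : Fin 5 → F} {e : Fin 5 → A}
    (h : IsCliffordSystem a e) (ha : ∀ i, a i ≠ 0) {S : Subalgebra F A} (h0 : e 0 ∈ S)
    (h1 : e 1 ∈ S) (h2 : e 0 * e 1 * e 2 ∈ S) (h3 : e 0 * e 1 * e 3 ∈ S)
    (hvol : volumeElement e ∈ S) : Set.range e ⊆ S := by
  have cancel {x : A} (hx : e 0 * (e 1 * x) ∈ S) : x ∈ S :=
    h.mem_of_mul_mem (ha 1) h1 (h.mem_of_mul_mem (ha 0) h0 hx)
  have h2' : e 2 ∈ S := cancel (mul_assoc (e 0) _ _ ▸ h2)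
  have h3' : e 3 ∈ S := cancel (mul_assoc (e 0) _ _ ▸ h3)
  have h4' : e 4 ∈ S := h.mem_of_mul_mem (ha 3) h3' <| h.mem_of_mul_mem (ha 2) h2' <| cancel <| by
    simpa [volumeElement, List.ofFn_succ] using hvol
  rintro _ ⟨i, rfl⟩
  fin_cases i
  exacts [h0, h1, h2', h3', h4']

theorem nonempty_biquaternion_algEquiv [Nontrivial A] {a : Fin 5 → F} {e : Fin 5 → A}
    (h : IsCliffordSystem a e) (h2 : (2 : F) ≠ 0) (ha : ∀ i, a i ≠ 0)
    (htop : Algebra.adjoin F (Set.range e) = ⊤) (hvol : volumeElement e ∈ (⊥ : Subalgebra F A)) :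
    Nonempty (ℍ[F, a 0, a 1] ⊗[F] ℍ[F, -(a 0 * a 1 * a 2), -(a 0 * a 1 * a 3)] ≃ₐ[F] A) := by
  have h01 : (0 : Fin 5) ≠ 1 := by decide
  have h' : IsCliffordSystem ![-(a 0 * a 1 * a 2), -(a 0 * a 1 * a 3)]
      ![e 0 * e 1 * e 2, e 0 * e 1 * e 3] := by
    convert h.mul_mul (f := ![2, 3]) h01 (by decide) (by decide) (by decide) using 1 <;>
      exact List.ofFn_injective rfl
  refine _root_.nonempty_biquaternion_algEquiv h2 (ha 0) (ha 1) (by simp [ha]) (by simp [ha])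
    (h.quaternionBasis h01) (h'.quaternionBasis zero_ne_one)
    (h.commute_left_mul_mul h01 (by decide)) (h.commute_left_mul_mul h01 (by decide))
    (h.commute_right_mul_mul h01 (by decide)) (h.commute_right_mul_mul h01 (by decide)) ?_
  rw [eq_top_iff, ← htop, Algebra.adjoin_le_iff]
  refine h.range_subset_of_volumeElement_mem ha ?_ ?_ ?_ ?_ (bot_le (α := Subalgebra F A) hvol) <;>
    exact Algebra.subset_adjoin (by simp)

end IsCliffordSystem

end CliffordSystem

section Center

variable {K L A : Type*} [Field K] [Field L] [Algebra K L] [Ring A] [Algebra K A]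

theorem two_ne_zero_of_algebra (L : Type*) [Field L] [Algebra K L] (h2 : (2 : K) ≠ 0) :
    (2 : L) ≠ 0 :=
  map_ofNat (algebraMap K L) 2 ▸ (map_ne_zero _).2 h2

theorem exists_algHom_apply_eq_of_sq_eq {R : Type*} [CommRing R] [Algebra K R] {Δ : K}
    (hΔ : ¬ IsSquare Δ) {δ : L} (hδ : δ ^ 2 = algebraMap K L Δ)
    (htop : IntermediateField.adjoin K {δ} = ⊤) {r : R} (hr : r ^ 2 = algebraMap K R Δ) :
    ∃ f : L →ₐ[K] R, f δ = r := by
  have hmonic : (Polynomial.X ^ 2 - Polynomial.C Δ).Monic :=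
    Polynomial.monic_X_pow_sub_C _ two_ne_zero
  have hmin : minpoly K δ = Polynomial.X ^ 2 - Polynomial.C Δ :=
    (minpoly.eq_of_irreducible_of_monic
      (X_pow_sub_C_irreducible_of_prime Nat.prime_two fun s hs => hΔ ⟨s, by rw [← hs, sq]⟩)
      (by simp [hδ]) hmonic).symm
  have hint : IsIntegral K δ := ⟨_, hmonic, by simp [hδ]⟩
  have hadj : Algebra.adjoin K {δ} = ⊤ := by
    rw [← IntermediateField.adjoin_simple_toSubalgebra_of_isAlgebraic hint.isAlgebraic, htop,
      IntermediateField.top_toSubalgebra]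
  let pb := PowerBasis.ofAdjoinEqTop hint hadj
  have hgen : pb.gen = δ := PowerBasis.ofAdjoinEqTop_gen hint hadj
  have hroot : Polynomial.aeval r (minpoly K pb.gen) = 0 := by simp [hgen, hmin, hr]
  exact ⟨pb.lift r hroot, (congrArg _ hgen.symm).trans (pb.lift_gen r hroot)⟩

/-- The `L`-algebra structure on `A` given by a homomorphism from `L` to the center of `A`.  For
the even Clifford algebra it is definitionally the one on `EvenCliffordOver`. -/
abbrev algebraOfCenter (ψ : L →ₐ[K] Subalgebra.center K A) : Algebra L A :=
  RingHom.toAlgebra' (((Subalgebra.center K A).val.comp ψ).toRingHom)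
    fun x y => ((Subalgebra.mem_center_iff.mp (ψ x).2) y).symm

theorem isScalarTower_algebraOfCenter (ψ : L →ₐ[K] Subalgebra.center K A) :
    letI := algebraOfCenter ψ
    IsScalarTower K L A :=
  let _ := algebraOfCenter ψ
  .of_algebraMap_eq fun k => congrArg Subtype.val (ψ.commutes k).symm

theorem surjective_of_isCentral_algebraOfCenter (ψ : L →ₐ[K] Subalgebra.center K A)
    (hA : letI := algebraOfCenter ψ; Algebra.IsCentral L A) : Function.Surjective ψ := by
  let := algebraOfCenter ψ
  intro z
  obtain ⟨l, hl⟩ := (Algebra.IsCentral.mem_center_iff L).1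
    (Subalgebra.mem_center_iff.2 (Subalgebra.mem_center_iff.1 z.2) : z.1 ∈ Subalgebra.center L A)
  exact ⟨l, Subtype.ext hl.symm⟩

theorem IsCliffordSystem.nonempty_biquaternion_algEquiv_algebraOfCenter [Nontrivial A]
    {a : Fin 5 → K} {e : Fin 5 → A} (h : IsCliffordSystem a e) (h2 : (2 : K) ≠ 0)
    (ha : ∀ i, a i ≠ 0) (htop : Algebra.adjoin K (Set.range e) = ⊤)
    (ψ : L →ₐ[K] Subalgebra.center K A) (hvol : ∃ l, (ψ l : A) = volumeElement e) :
    letI := algebraOfCenter ψ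
    Nonempty (ℍ[L, algebraMap K L (a 0), algebraMap K L (a 1)] ⊗[L]
      ℍ[L, algebraMap K L (-(a 0 * a 1 * a 2)), algebraMap K L (-(a 0 * a 1 * a 3))] ≃ₐ[L] A) := by
  let := algebraOfCenter ψ
  have := isScalarTower_algebraOfCenter ψ
  have htopL : Algebra.adjoin L (Set.range e) = ⊤ := by
    have hle : Algebra.adjoin K (Set.range e) ≤
        (Algebra.adjoin L (Set.range e)).restrictScalars K :=
      Algebra.adjoin_le Algebra.subset_adjoin
    exact eq_top_iff.2 fun x _ => hle (htop ▸ Algebra.mem_top : x ∈ _)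
  have h2L : (2 : L) ≠ 0 := two_ne_zero_of_algebra L h2
  rw [map_neg, map_mul, map_mul, map_neg, map_mul, map_mul]
  exact (h.extendScalars L).nonempty_biquaternion_algEquiv h2L
    (fun i => (map_ne_zero _).2 (ha i)) htopL (Algebra.mem_bot.2 hvol)

end Center

section BrauerClass

variable {F A B : Type u} [Field F] [Ring A] [Algebra F A] [Ring B] [Algebra F B]

theorem exists_hasBrauerClass [Algebra.IsCentral F A] [IsSimpleRing A] [FiniteDimensional F A] :
    ∃ β, HasBrauerClass F A β :=
  let T : CSA.{u, u} F :=
    { AlgCat.of F A with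
      isCentral := ‹_›
      isSimple := ‹_›
      fin_dim := ‹_› }
  ⟨_, T, ⟨AlgEquiv.refl⟩, rfl⟩

theorem HasBrauerClass.of_algEquiv {β : BrauerGroup.{u, u} F} (h : HasBrauerClass F A β)
    (e : A ≃ₐ[F] B) : HasBrauerClass F B β := by
  obtain ⟨C, ⟨f⟩, hC⟩ := h
  exact ⟨C, ⟨e.symm.trans f⟩, hC⟩

end BrauerClass

section EvenCliffordClass

variable {K V L : Type u} [Field K] [AddCommGroup V] [Module K V] [Field L] [Algebra K L]
  {q : QuadraticForm K V}

theorem EvenCliffordClassEq.of_algEquiv {α β γ δ α' β' γ' δ' : L}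
    (h : EvenCliffordClassEq q α β γ δ) (e₁ : ℍ[L, α, β] ≃ₐ[L] ℍ[L, α', β'])
    (e₂ : ℍ[L, γ, δ] ≃ₐ[L] ℍ[L, γ', δ']) : EvenCliffordClassEq q α' β' γ' δ' := by
  refine ⟨h.1, fun φ => ?_⟩
  obtain ⟨c₀, hc₀, hquat⟩ := h.2 φ
  exact ⟨c₀, hc₀, hquat.of_algEquiv (Algebra.TensorProduct.congr e₁ e₂)⟩

theorem evenCliffordClassEq_of_isCliffordSystem [Nontrivial (CliffordAlgebra q)] {a : Fin 5 → K}
    {e : Fin 5 → CliffordAlgebra.even q} (h : IsCliffordSystem a e) (h2 : (2 : K) ≠ 0)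
    (ha : ∀ i, a i ≠ 0) (htop : Algebra.adjoin K (Set.range e) = ⊤)
    (ψ : L →ₐ[K] Subalgebra.center K (CliffordAlgebra.even q))
    (hψ : ∃ l, (ψ l : CliffordAlgebra.even q) = volumeElement e) :
    EvenCliffordClassEq q (algebraMap K L (a 0)) (algebraMap K L (a 1))
      (algebraMap K L (-(a 0 * a 1 * a 2))) (algebraMap K L (-(a 0 * a 1 * a 3))) := by
  have h2L : (2 : L) ≠ 0 := two_ne_zero_of_algebra L h2
  have hne {x : K} (hx : x ≠ 0) : algebraMap K L x ≠ 0 := (map_ne_zero _).2 hx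
  have h012 : -(a 0 * a 1 * a 2) ≠ 0 := by simp [ha]
  have h013 : -(a 0 * a 1 * a 3) ≠ 0 := by simp [ha]
  have := isSimpleRing_biquaternion h2L (hne (ha 0)) (hne (ha 1)) (hne h012) (hne h013)
  have := isCentral_biquaternion (b := algebraMap K L (a 1))
    (d := algebraMap K L (-(a 0 * a 1 * a 3))) h2L (hne (ha 0)) (hne h012)
  have hsurj : Function.Surjective ψ := by
    obtain ⟨f⟩ := h.nonempty_biquaternion_algEquiv_algebraOfCenter h2 ha htop ψ hψ
    let := algebraOfCenter ψ
    exact surjective_of_isCentral_algebraOfCenter ψ (.of_algEquiv L _ _ f)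
  refine ⟨⟨AlgEquiv.ofBijective ψ ⟨ψ.toRingHom.injective, hsurj⟩⟩, fun φ => ?_⟩
  obtain ⟨l, hl⟩ := hψ
  obtain ⟨f⟩ := h.nonempty_biquaternion_algEquiv_algebraOfCenter h2 ha htop φ.toAlgHom
    ⟨φ.symm (ψ l), hl ▸ congrArg Subtype.val (φ.apply_symm_apply (ψ l))⟩
  obtain ⟨c₀, hc₀⟩ := exists_hasBrauerClass (F := L)
    (A := ℍ[L, algebraMap K L (a 0), algebraMap K L (a 1)] ⊗[L]
      ℍ[L, algebraMap K L (-(a 0 * a 1 * a 2)), algebraMap K L (-(a 0 * a 1 * a 3))])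
  exact ⟨c₀, hc₀.of_algEquiv (B := EvenCliffordOver φ) f, hc₀⟩

end EvenCliffordClass

section EvenClifford

variable {R M : Type*} [CommRing R] [AddCommGroup M] [Module R M] {Q : QuadraticForm R M}

theorem even_ι_comm (m₁ m₂ : M) :
    (CliffordAlgebra.even.ι Q).bilin m₁ m₂ =
      algebraMap R _ (QuadraticMap.polar Q m₁ m₂) - (CliffordAlgebra.even.ι Q).bilin m₂ m₁ :=
  Subtype.ext (CliffordAlgebra.ι_mul_ι_comm m₁ m₂)

theorem even_ι_comm_of_isOrtho {m₁ m₂ : M} (h : Q.IsOrtho m₁ m₂) :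
    (CliffordAlgebra.even.ι Q).bilin m₁ m₂ = -(CliffordAlgebra.even.ι Q).bilin m₂ m₁ :=
  Subtype.ext (CliffordAlgebra.ι_mul_ι_comm_of_isOrtho h)

theorem even_ι_mul_even_ι_of_isOrtho {m₀ m₁ : M} (h : Q.IsOrtho m₀ m₁) (m₂ : M) :
    (CliffordAlgebra.even.ι Q).bilin m₀ m₁ * (CliffordAlgebra.even.ι Q).bilin m₀ m₂ =
      -(Q m₀ • (CliffordAlgebra.even.ι Q).bilin m₁ m₂) := by
  rw [even_ι_comm_of_isOrtho h, neg_mul, (CliffordAlgebra.even.ι Q).contract_mid]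

theorem adjoin_range_even_ι :
    Algebra.adjoin R (Set.range fun m : M × M => (CliffordAlgebra.even.ι Q).bilin m.1 m.2) = ⊤ := by
  set S := Algebra.adjoin R
    (Set.range fun m : M × M => (CliffordAlgebra.even.ι Q).bilin m.1 m.2)
  have key (x : CliffordAlgebra Q) (hx : x ∈ CliffordAlgebra.evenOdd Q 0) :
      x ∈ S.map (CliffordAlgebra.even Q).val := by
    induction x, hx using CliffordAlgebra.even_induction with
    | algebraMap r => exact Subalgebra.algebraMap_mem _ r
    | add x y _ _ hx hy => exact Subalgebra.add_mem _ hx hy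
    | ι_mul_ι_mul m₁ m₂ x _ hx =>
      exact Subalgebra.mul_mem _ ⟨_, Algebra.subset_adjoin ⟨(m₁, m₂), rfl⟩, rfl⟩ hx
  refine eq_top_iff.2 fun x _ => ?_
  obtain ⟨y, hy, hyx⟩ := key x.1 x.2
  rwa [← Subtype.ext hyx]

variable {K V : Type*} [Field K] [AddCommGroup V] [Module K V] {q : QuadraticForm K V}

theorem adjoin_range_even_ι_left {v₀ : V} (h : q v₀ ≠ 0) :
    Algebra.adjoin K (Set.range ((CliffordAlgebra.even.ι q).bilin v₀)) = ⊤ := by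
  set S := Algebra.adjoin K (Set.range ((CliffordAlgebra.even.ι q).bilin v₀))
  have left_mem (v : V) : (CliffordAlgebra.even.ι q).bilin v₀ v ∈ S :=
    Algebra.subset_adjoin ⟨v, rfl⟩
  have right_mem (v : V) : (CliffordAlgebra.even.ι q).bilin v v₀ ∈ S := by
    rw [even_ι_comm]
    exact S.sub_mem (S.algebraMap_mem _) (left_mem v)
  rw [eq_top_iff, ← adjoin_range_even_ι, Algebra.adjoin_le_iff]
  rintro _ ⟨⟨v, w⟩, rfl⟩
  have := S.smul_mem (S.mul_mem (right_mem v) (left_mem w)) (q v₀)⁻¹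
  rwa [(CliffordAlgebra.even.ι q).contract_mid, inv_smul_smul₀ h] at this

theorem adjoin_range_even_ι_basis {n : ℕ} (v : Module.Basis (Fin (n + 1)) K V)
    (h : q (v 0) ≠ 0) :
    Algebra.adjoin K
      (Set.range fun i : Fin n => (CliffordAlgebra.even.ι q).bilin (v 0) (v i.succ)) = ⊤ := by
  set S := Algebra.adjoin K
    (Set.range fun i : Fin n => (CliffordAlgebra.even.ι q).bilin (v 0) (v i.succ))
  have basis_mem (i : Fin (n + 1)) : (CliffordAlgebra.even.ι q).bilin (v 0) (v i) ∈ S := by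
    cases i using Fin.cases with
    | zero => exact (CliffordAlgebra.even.ι q).contract (v 0) ▸ S.algebraMap_mem _
    | succ i => exact Algebra.subset_adjoin ⟨i, rfl⟩
  rw [eq_top_iff, ← adjoin_range_even_ι_left h, Algebra.adjoin_le_iff]
  rintro _ ⟨w, rfl⟩
  rw [← v.sum_repr w, map_sum]
  exact S.sum_mem fun i _ => by simpa only [map_smul] using S.smul_mem (basis_mem i) _

theorem isCliffordSystem_even_ι {n : ℕ} {v : Fin (n + 1) → V}
    (hv : Pairwise fun i j => q.IsOrtho (v i) (v j)) :
    IsCliffordSystem (fun i : Fin n => -(q (v 0) * q (v i.succ)))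
      (fun i : Fin n => (CliffordAlgebra.even.ι q).bilin (v 0) (v i.succ)) where
  mul_self i := by
    rw [even_ι_mul_even_ι_of_isOrtho (hv i.succ_ne_zero.symm),
      (CliffordAlgebra.even.ι q).contract, map_neg, map_mul, Algebra.smul_def]
  anticomm {i j} hij := by
    rw [even_ι_mul_even_ι_of_isOrtho (hv i.succ_ne_zero.symm),
      even_ι_mul_even_ι_of_isOrtho (hv j.succ_ne_zero.symm),
      even_ι_comm_of_isOrtho (hv ((Fin.succ_injective n).ne hij)), smul_neg]

end EvenClifford

section Discriminant

theorem quadraticForm_toMatrix_change_basis {R M n : Type*} [CommRing R] [Invertible (2 : R)]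
    [AddCommGroup M] [Module R M] [Fintype n] [DecidableEq n] (b v : Module.Basis n R M)
    (Q : QuadraticForm R M) :
    Q.toMatrix v = (b.toMatrix v).transpose * Q.toMatrix b * b.toMatrix v := by
  have := QuadraticForm.toMatrix_comp v b Q LinearMap.id
  rwa [LinearMap.toMatrix_id_eq_basis_toMatrix, show Q.comp LinearMap.id = Q from rfl] at this

variable {K V : Type*} [Field K] [Invertible (2 : K)] [AddCommGroup V] [Module K V]
  {q : QuadraticForm K V}

theorem quadraticForm_toMatrix_eq_diagonal_iff {n : Type*} [Fintype n] [DecidableEq n]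
    (v : Module.Basis n K V) (d : n → K) :
    q.toMatrix v = Matrix.diagonal d ↔
      (Pairwise fun i j => q.IsOrtho (v i) (v j)) ∧ ∀ i, q (v i) = d i := by
  have apply_eq (i j : n) : q.toMatrix v i j = QuadraticMap.associated (R := K) q (v i) (v j) := by
    simp [QuadraticForm.toMatrix]
  have isOrtho_iff (i j : n) : q.IsOrtho (v i) (v j) ↔ q.toMatrix v i j = 0 := by
    rw [apply_eq]
    exact QuadraticMap.associated_isOrtho.symm
  have apply_self (i : n) : q (v i) = q.toMatrix v i i := by
    rw [apply_eq, QuadraticMap.associated_eq_self_apply K q]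
  simp only [isOrtho_iff, apply_self]
  refine ⟨fun h => ⟨fun i j hij => ?_, fun i => ?_⟩, fun ⟨hortho, hd⟩ => ?_⟩
  · simp [h, hij]
  · simp [h]
  · ext i j
    obtain rfl | hij := eq_or_ne i j
    · rw [hd, Matrix.diagonal_apply_eq]
    · rw [hortho hij, Matrix.diagonal_apply_ne _ hij]

theorem signedDiscriminant_of_isOrtho {n : ℕ} (v : Module.Basis (Fin n) K V)
    (hv : Pairwise fun i j => q.IsOrtho (v i) (v j)) :
    signedDiscriminant v q = (-1) ^ (n * (n - 1) / 2) * ∏ i, q (v i) := by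
  rw [signedDiscriminant, QuadraticForm.discr,
    (quadraticForm_toMatrix_eq_diagonal_iff v fun i => q (v i)).2 ⟨hv, fun _ => rfl⟩,
    Matrix.det_diagonal]

theorem signedDiscriminant_change_basis {n : ℕ} (b v : Module.Basis (Fin n) K V) :
    signedDiscriminant v q = (b.toMatrix v).det ^ 2 * signedDiscriminant b q := by
  rw [signedDiscriminant, signedDiscriminant, QuadraticForm.discr,
    quadraticForm_toMatrix_change_basis b v, Matrix.det_mul, Matrix.det_mul,
    Matrix.det_transpose, QuadraticForm.discr]
  ring

namespace IsNontrivialDiscriminantExtension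

variable {L : Type*} [Field L] [Algebra K L] {n : ℕ} {b : Module.Basis (Fin n) K V}

theorem change_basis (h : IsNontrivialDiscriminantExtension L b q)
    (v : Module.Basis (Fin n) K V) : IsNontrivialDiscriminantExtension L v q := by
  obtain ⟨hsq, δ, hδ, htop⟩ := h
  obtain ⟨s, hs0, hs⟩ : ∃ s : K, s ≠ 0 ∧
      signedDiscriminant v q = s ^ 2 * signedDiscriminant b q :=
    ⟨_, (b.isUnit_det v).ne_zero, signedDiscriminant_change_basis b v⟩
  have hδs : algebraMap K L s⁻¹ * (algebraMap K L s * δ) = δ := by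
    rw [← mul_assoc, ← map_mul, inv_mul_cancel₀ hs0, map_one, one_mul]
  refine ⟨fun ⟨r, hr⟩ => hsq ⟨s⁻¹ * r, ?_⟩, algebraMap K L s * δ, ?_, ?_⟩
  · rw [mul_mul_mul_comm, ← hr, hs]
    field_simp
  · rw [mul_pow, hδ, hs, map_mul, map_pow]
  · rw [eq_top_iff, ← htop, IntermediateField.adjoin_simple_le_iff]
    have := mul_mem (IntermediateField.algebraMap_mem _ s⁻¹)
      (IntermediateField.mem_adjoin_simple_self K (algebraMap K L s * δ))
    rwa [hδs] at this

theorem apply_ne_zero (h : IsNontrivialDiscriminantExtension L b q)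
    (hb : Pairwise fun i j => q.IsOrtho (b i) (b j)) (i : Fin n) : q (b i) ≠ 0 := by
  refine fun hi => h.not_isSquare ?_
  rw [signedDiscriminant_of_isOrtho b hb, Finset.prod_eq_zero (Finset.mem_univ i) hi, mul_zero]
  exact .zero

end IsNontrivialDiscriminantExtension

end Discriminant

section OrthogonalBasis

theorem exists_algHom_center_apply_eq_volumeElement {K L V : Type*} [Field K]
    [Invertible (2 : K)] [AddCommGroup V] [Module K V] [Field L] [Algebra K L]
    {q : QuadraticForm K V} (v : Module.Basis (Fin 6) K V)
    (hv : Pairwise fun i j => q.IsOrtho (v i) (v j))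
    (hL : IsNontrivialDiscriminantExtension L v q) :
    ∃ (ψ : L →ₐ[K] Subalgebra.center K (CliffordAlgebra.even q)) (l : L),
      (ψ l : CliffordAlgebra.even q) =
        volumeElement fun i : Fin 5 => (CliffordAlgebra.even.ι q).bilin (v 0) (v i.succ) := by
  have h0 : q (v 0) ≠ 0 := hL.apply_ne_zero hv 0
  have hC := isCliffordSystem_even_ι hv
  obtain ⟨hsq, δ, hδ, htop⟩ := hL
  let t : Subalgebra.center K (CliffordAlgebra.even q) :=
    ⟨_, hC.volumeElement_mem_center (by decide) (adjoin_range_even_ι_basis v h0)⟩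
  have ht : (algebraMap K _ (q (v 0) ^ 2)⁻¹ * t) ^ 2 =
      algebraMap K _ (signedDiscriminant v q) := by
    have htt : t * t = algebraMap K _ (q (v 0) ^ 4 * signedDiscriminant v q) := by
      refine Subtype.ext (hC.volumeElement_mul_self.trans ?_)
      rw [signedDiscriminant_of_isOrtho v hv]
      refine congrArg (algebraMap K (CliffordAlgebra.even q)) ?_
      simp only [Fin.prod_univ_succ, Fin.prod_univ_zero]
      norm_num
      ring
    rw [mul_pow, sq t, htt, ← map_pow, ← map_mul]
    congr 1
    field_simp
  obtain ⟨ψ, hψ⟩ := exists_algHom_apply_eq_of_sq_eq hsq hδ htop ht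
  refine ⟨ψ, algebraMap K L (q (v 0) ^ 2) * δ, congrArg Subtype.val (?_ : _ = t)⟩
  rw [map_mul, hψ, ψ.commutes, ← mul_assoc, ← map_mul, mul_inv_cancel₀ (pow_ne_zero 2 h0),
    map_one, one_mul]

theorem evenCliffordClassEq_of_isOrtho {K L V : Type u} [Field K] [Invertible (2 : K)]
    [AddCommGroup V] [Module K V] [Field L] [Algebra K L] {q : QuadraticForm K V}
    {b : Module.Basis (Fin 6) K V} (hL : IsNontrivialDiscriminantExtension L b q)
    (v : Module.Basis (Fin 6) K V) (hv : Pairwise fun i j => q.IsOrtho (v i) (v j)) :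
    EvenCliffordClassEq q (algebraMap K L (-(q (v 0) * q (v 1))))
      (algebraMap K L (-(q (v 0) * q (v 2))))
      (algebraMap K L (q (v 0) * q (v 1) * q (v 2) * q (v 3)))
      (algebraMap K L (q (v 0) * q (v 1) * q (v 2) * q (v 4))) := by
  have hLv := hL.change_basis v
  have hne (i : Fin 6) : q (v i) ≠ 0 := hLv.apply_ne_zero hv i
  have h2 : (2 : K) ≠ 0 := Invertible.ne_zero 2
  have h2L : (2 : L) ≠ 0 := two_ne_zero_of_algebra L h2
  obtain ⟨ψ, hψ⟩ := exists_algHom_center_apply_eq_volumeElement v hv hLv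
  have hclass := evenCliffordClassEq_of_isCliffordSystem (isCliffordSystem_even_ι hv) h2
    (by simp [hne]) (adjoin_range_even_ι_basis v (hne 0)) ψ hψ
  obtain ⟨e⟩ := nonempty_quaternionAlgebra_algEquiv_mul_sq
    (a := algebraMap K L (q (v 0) * q (v 1) * q (v 2) * q (v 3)))
    (b := algebraMap K L (q (v 0) * q (v 1) * q (v 2) * q (v 4)))
    (s := algebraMap K L (q (v 0))) (t := algebraMap K L (q (v 0))) h2L (by simp [hne])
    (by simp [hne]) (by simp [hne]) (by simp [hne])
  refine EvenCliffordClassEq.of_algEquiv (e₁ := .refl) (e₂ := e.symm) ?_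
  convert hclass using 1 <;> simp only [Fin.reduceSucc, ← map_mul, ← map_pow] <;> congr 1 <;> ring

end OrthogonalBasis

section Diagonalization

theorem exists_basis_isOrtho_of_equivalent_weightedSumSquares {ι K V : Type*} [Fintype ι]
    [CommRing K] [AddCommGroup V] [Module K V] {q : QuadraticForm K V} {a : ι → K}
    (h : q.Equivalent (QuadraticMap.weightedSumSquares K a)) :
    ∃ v : Module.Basis ι K V, (Pairwise fun i j => q.IsOrtho (v i) (v j)) ∧
      ∀ i, q (v i) = a i := by
  classical
  obtain ⟨f⟩ := h
  let v : Module.Basis ι K V := (Pi.basisFun K ι).map f.symm.toLinearEquiv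
  have hv (i : ι) : f (v i) = Pi.single i 1 := by simp [v]
  refine ⟨v, fun i j hij => ?_, fun i => ?_⟩
  · change q.IsOrtho (v i) (v j)
    rw [QuadraticMap.isOrtho_def, ← f.map_app, ← f.map_app (v i), ← f.map_app (v j), map_add,
      hv, hv]
    simp only [QuadraticMap.weightedSumSquares_apply, ← Finset.sum_add_distrib, ← smul_add]
    refine Finset.sum_congr rfl fun k _ => congrArg (a k • ·) ?_
    obtain rfl | hk := eq_or_ne k i
    · simp [hij]
    · simp [hk]
  · simp [← f.map_app, hv, QuadraticMap.weightedSumSquares_apply, Pi.single_apply]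

section Matrix

open Matrix

theorem transpose_mul_fromBlocks_mul {R m n : Type*} [CommRing R] [Fintype m] [DecidableEq m]
    [Fintype n] [DecidableEq n] {B : Matrix m m R} (hB : B.IsSymm) (hdet : IsUnit B.det)
    (w : Matrix m n R) (c : Matrix n n R) (U : Matrix m m R) :
    (fromBlocks U (-(B⁻¹ * w)) 0 1)ᵀ * fromBlocks B w wᵀ c * fromBlocks U (-(B⁻¹ * w)) 0 1 =
      fromBlocks (Uᵀ * B * U) 0 0 (c - wᵀ * B⁻¹ * w) := by
  have hBinv : (B⁻¹)ᵀ = B⁻¹ := by rw [transpose_nonsing_inv, hB.eq]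
  simp only [fromBlocks_transpose, fromBlocks_multiply]
  congr 1
  · simp
  · simp [Matrix.mul_assoc, mul_nonsing_inv_cancel_left _ _ hdet]
  · simp [hBinv, nonsing_inv_mul_cancel_right _ _ hdet]
  · simp [hBinv, nonsing_inv_mul_cancel_right _ _ hdet, sub_eq_neg_add]

variable {K : Type*} [Field K] {n : ℕ}

theorem exists_transpose_mul_mul_eq_diagonal_snoc {M : Matrix (Fin (n + 1)) (Fin (n + 1)) K}
    (hM : M.IsSymm) (hdet : (M.submatrix Fin.castSucc Fin.castSucc).det ≠ 0)
    {U : Matrix (Fin n) (Fin n) K} (hU : U.det = 1) {d : Fin n → K}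
    (hd : Uᵀ * M.submatrix Fin.castSucc Fin.castSucc * U = diagonal d) :
    ∃ W : Matrix (Fin (n + 1)) (Fin (n + 1)) K, W.det = 1 ∧ Wᵀ * M * W =
      diagonal (Fin.snoc d (M.det / (M.submatrix Fin.castSucc Fin.castSucc).det)) := by
  let ε : Fin n ⊕ Fin 1 ≃ Fin (n + 1) := finSumFinEquiv
  set B := M.submatrix Fin.castSucc Fin.castSucc
  let w := (M.submatrix ε ε).toBlocks₁₂
  let c := (M.submatrix ε ε).toBlocks₂₂
  have hblocks : M.submatrix ε ε = fromBlocks B w wᵀ c := by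
    rw [← fromBlocks_toBlocks (M.submatrix ε ε)]
    congr 1
    ext i j
    exact hM.apply _ _
  have hunit : IsUnit B.det := isUnit_iff_ne_zero.2 hdet
  have hschur : c - wᵀ * B⁻¹ * w = diagonal fun _ => M.det / B.det := by
    have := B.invertibleOfIsUnitDet hunit
    ext i j
    rw [Subsingleton.elim i 0, Subsingleton.elim j 0, diagonal_apply_eq, eq_div_iff hdet, mul_comm,
      ← det_submatrix_equiv_self ε M, hblocks, det_fromBlocks₁₁, invOf_eq_nonsing_inv, det_fin_one]
  let W : Matrix (Fin n ⊕ Fin 1) (Fin n ⊕ Fin 1) K := fromBlocks U (-(B⁻¹ * w)) 0 1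
  have hW : Wᵀ * M.submatrix ε ε * W =
      (diagonal (Fin.snoc d (M.det / B.det) : Fin (n + 1) → K)).submatrix ε ε := by
    rw [hblocks, transpose_mul_fromBlocks_mul (hM.submatrix _) hunit, hd, hschur,
      fromBlocks_diagonal, submatrix_diagonal_equiv]
    congr 1
    ext (i | i)
    · exact (Fin.snoc_castSucc (α := fun _ => K) _ d i).symm
    · obtain rfl := Subsingleton.elim i 0
      exact (Fin.snoc_last (α := fun _ => K) _ d).symm
  refine ⟨W.submatrix ε.symm ε.symm, by simp [W, hU], ?_⟩
  have hMε : M = (M.submatrix ε ε).submatrix ε.symm ε.symm := by simp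
  calc (W.submatrix ε.symm ε.symm)ᵀ * M * W.submatrix ε.symm ε.symm
      = (Wᵀ * M.submatrix ε ε * W).submatrix ε.symm ε.symm := by
        conv_lhs => rw [hMε]
        rw [transpose_submatrix, submatrix_mul_equiv, submatrix_mul_equiv]
    _ = diagonal (Fin.snoc d (M.det / B.det)) := by
        rw [hW, submatrix_submatrix, ε.self_comp_symm, submatrix_id_id]

theorem exists_transpose_mul_mul_eq_diagonal {M : Matrix (Fin n) (Fin n) K} (hM : M.IsSymm)
    (hm : ∀ (i : ℕ) (hi : i < n), leadingPrincipalMinor M i hi.le ≠ 0) :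
    ∃ U : Matrix (Fin n) (Fin n) K, U.det = 1 ∧ Uᵀ * M * U = diagonal fun i : Fin n =>
      leadingPrincipalMinor M (i + 1) i.isLt / leadingPrincipalMinor M i i.isLt.le := by
  induction n with
  | zero => exact ⟨1, by simp, Subsingleton.elim _ _⟩
  | succ n ih =>
    obtain ⟨U, hU, hd⟩ := ih (hM.submatrix Fin.castSucc) fun i hi => hm i (hi.trans n.lt_succ_self)
    obtain ⟨W, hW, hdiag⟩ :=
      exists_transpose_mul_mul_eq_diagonal_snoc hM (hm n n.lt_succ_self) hU hd
    refine ⟨W, hW, hdiag.trans (congrArg _ (funext fun i => ?_))⟩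
    cases i using Fin.lastCases with
    | last => exact Fin.snoc_last (α := fun _ => K) _ _
    | cast i => exact Fin.snoc_castSucc (α := fun _ => K) _ _ i

end Matrix

theorem EvenCliffordClassEq.neg_mul {K V L : Type u} [Field K] [AddCommGroup V] [Module K V]
    [Field L] [Algebra K L] {q : QuadraticForm K V} {α β γ δ : L} (h2 : (2 : L) ≠ 0)
    (hα : α ≠ 0) (hβ : β ≠ 0) (hγ : γ ≠ 0) (hδ : δ ≠ 0) (h : EvenCliffordClassEq q α β γ δ) :
    EvenCliffordClassEq q α (-(α * β)) γ (-(γ * δ)) := by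
  obtain ⟨e₁⟩ := nonempty_quaternionAlgebra_algEquiv_neg_mul h2 hα hβ
  obtain ⟨e₂⟩ := nonempty_quaternionAlgebra_algEquiv_neg_mul h2 hγ hδ
  exact h.of_algEquiv e₁ e₂

theorem exists_basis_isOrtho_of_leadingPrincipalMinor_ne_zero {K V : Type*} [Field K]
    [Invertible (2 : K)] [AddCommGroup V] [Module K V] {n : ℕ} (b : Module.Basis (Fin n) K V)
    (q : QuadraticForm K V)
    (hm : ∀ (i : ℕ) (hi : i < n), leadingPrincipalMinor (q.toMatrix b) i hi.le ≠ 0) :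
    ∃ v : Module.Basis (Fin n) K V, (Pairwise fun i j => q.IsOrtho (v i) (v j)) ∧
      ∀ i : Fin n, q (v i) = leadingPrincipalMinor (q.toMatrix b) (i + 1) i.isLt /
        leadingPrincipalMinor (q.toMatrix b) i i.isLt.le := by
  obtain ⟨U, hU, hdiag⟩ :=
    exists_transpose_mul_mul_eq_diagonal (QuadraticForm.isSymm_toMatrix (b := b) q) hm
  let f : V ≃ₗ[K] V := U.toLinearEquiv b (by simp [hU])
  have hf : b.toMatrix (b.map f) = U := by
    ext i j
    rw [← LinearMap.toMatrix_toLin b b U, LinearMap.toMatrix_apply]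
    rfl
  refine ⟨b.map f, (quadraticForm_toMatrix_eq_diagonal_iff _ _).1 ?_⟩
  rw [quadraticForm_toMatrix_change_basis b, hf, hdiag]

theorem evenCliffordClassEq_of_apply_eq_div {K L V : Type u} [Field K] [Invertible (2 : K)]
    [AddCommGroup V] [Module K V] [Field L] [Algebra K L] {q : QuadraticForm K V}
    {b : Module.Basis (Fin 6) K V} (hL : IsNontrivialDiscriminantExtension L b q)
    (v : Module.Basis (Fin 6) K V) (hv : Pairwise fun i j => q.IsOrtho (v i) (v j)) {m : ℕ → K}
    (h0 : m 0 = 1) (hqv : ∀ i : Fin 6, q (v i) = m (i + 1) / m i) :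
    EvenCliffordClassEq q (algebraMap K L (-m 2)) (algebraMap K L (-(m 1 * m 3)))
      (algebraMap K L (m 4)) (algebraMap K L (-(m 3 * m 5))) := by
  have hne (i : Fin 6) : q (v i) ≠ 0 := (hL.change_basis v).apply_ne_zero hv i
  have hm (i : Fin 6) : m i ≠ 0 := (div_ne_zero_iff.1 (hqv i ▸ hne i)).2
  have h1 : m 1 ≠ 0 := hm 1
  have h2 : m 2 ≠ 0 := hm 2
  have h3 : m 3 ≠ 0 := hm 3
  have h4 : m 4 ≠ 0 := hm 4
  have hq0 : q (v 0) = m 1 := by simpa [h0] using hqv 0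
  have hq1 : q (v 1) = m 2 / m 1 := hqv 1
  have hq2 : q (v 2) = m 3 / m 2 := hqv 2
  have hq3 : q (v 3) = m 4 / m 3 := hqv 3
  have hq4 : q (v 4) = m 5 / m 4 := hqv 4
  have h2L : (2 : L) ≠ 0 := two_ne_zero_of_algebra L (Invertible.ne_zero (2 : K))
  convert (evenCliffordClassEq_of_isOrtho hL v hv).neg_mul h2L (by simp [hne])
    (by simp [hne]) (by simp [hne]) (by simp [hne]) using 1 <;>
  · simp only [hq0, hq1, hq2, hq3, hq4, ← map_mul, ← map_neg]
    congr 1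
    field_simp

end Diagonalization

theorem mainTheorem11 {K L V : Type u} [Field K] [Invertible (2 : K)] [Field L] [Algebra K L]
    [AddCommGroup V] [Module K V] (q : QuadraticForm K V) (b : Module.Basis (Fin 6) K V)
    (hq : q.Nondegenerate) (hL : IsNontrivialDiscriminantExtension L b q) :
    (∀ a₁ a₂ a₃ a₄ a₅ a₆ : K,
      QuadraticMap.Equivalent q
        (QuadraticMap.weightedSumSquares K ![a₁, a₂, a₃, a₄, a₅, a₆]) →
      EvenCliffordClassEq q
        (algebraMap K L (-(a₁ * a₂))) (algebraMap K L (-(a₁ * a₃)))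
        (algebraMap K L (a₁ * a₂ * a₃ * a₄)) (algebraMap K L (a₁ * a₂ * a₃ * a₅))) ∧
    (∀ m : ℕ → K,
      (∀ (i : ℕ) (hi : i ≤ 6), m i = leadingPrincipalMinor (QuadraticForm.toMatrix b q) i hi) →
      m 1 ≠ 0 → m 2 ≠ 0 → m 3 ≠ 0 → m 4 ≠ 0 → m 5 ≠ 0 →
      EvenCliffordClassEq q
        (algebraMap K L (-m 2)) (algebraMap K L (-(m 1 * m 3)))
        (algebraMap K L (m 4)) (algebraMap K L (-(m 3 * m 5)))) := by
  refine ⟨fun a₁ a₂ a₃ a₄ a₅ a₆ h => ?_, fun m hm h1 h2 h3 h4 h5 => ?_⟩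
  · obtain ⟨v, hv, hqv⟩ := exists_basis_isOrtho_of_equivalent_weightedSumSquares h
    simpa [hqv] using evenCliffordClassEq_of_isOrtho hL v hv
  · have h0 : m 0 = 1 := by simp [hm 0 (by norm_num), leadingPrincipalMinor]
    obtain ⟨v, hv, hqv⟩ := exists_basis_isOrtho_of_leadingPrincipalMinor_ne_zero b q
      fun i hi => by
        rw [← hm]
        interval_cases i
        exacts [h0 ▸ one_ne_zero, h1, h2, h3, h4, h5]
    exact evenCliffordClassEq_of_apply_eq_div hL v hv h0 fun i => by rw [hqv, ← hm, ← hm]
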